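/- Let $q$ be a prime power and let $\mathbb{F}_q$ be a finite field with $q$ elements. A prime of $\mathbb{F}_q[T]$ is a monic irreducible polynomial. For a monic polynomial $A\in\mathbb{F}_q[T]$ let $\mu(A)=(-1)^k$ if $A$ is a product of $k\ge 0$ distinct primes (so $\mu(1)=1$) and $\mu(A)=0$ otherwise. Let $\mathcal{N}(A)=\{\deg P : P \text{ prime},\ P\mid A\}$, let $\Omega(A)=\#\mathcal{N}(A)$ be the number of distinct degrees of primes dividing $A$, and let $\delta_1(A)$ be the smallest element of $\mathcal{N}(A)$, with $\delta_1(A)=0$ if $\mathcal{N}(A)$ is empty. Then for every positive integer $n$, $$\lim_{x\to\infty}\ \sum_{\substack{A\in\mathbb{F}_q[T]\ \text{monic}\\ 1\le \deg A\le x\\ \delta_1(A)=n}}\frac{\mu(A)\,\Omega(A)}{q^{\deg A}}=0,$$ where $x$ runs over the positive integers. -/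

import Mathlib

open Polynomial

namespace FunctionField

/-- Over a finite field there are only finitely many monic polynomials `A` with
`1 ≤ deg A ≤ x`. -/
theorem finite_monic_natDegree_le (F : Type*) [Field F] [Fintype F] (x : ℕ) :
    {A : F[X] | A.Monic ∧ 1 ≤ A.natDegree ∧ A.natDegree ≤ x}.Finite := by
  refine Set.Finite.of_finite_image (f := fun (A : F[X]) (i : Fin (x + 1)) => A.coeff i)
    (Set.toFinite _) ?_
  intro A hA B hB h
  ext i
  rcases Nat.lt_or_ge i (x + 1) with hi | hi
  · exact congrFun h ⟨i, hi⟩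
  · rw [coeff_eq_zero_of_natDegree_lt (lt_of_le_of_lt hA.2.2 hi),
      coeff_eq_zero_of_natDegree_lt (lt_of_le_of_lt hB.2.2 hi)]

/-- The finite set of monic polynomials `A` over `F` with `1 ≤ deg A ≤ x`. -/
noncomputable def monicsUpTo (F : Type*) [Field F] [Fintype F] (x : ℕ) : Finset F[X] :=
  (finite_monic_natDegree_le F x).toFinset

/-- A prime of `F[X]` is a monic irreducible polynomial. -/
def IsMonicPrime {F : Type*} [Field F] (P : F[X]) : Prop :=
  P.Monic ∧ Irreducible P

/-- `𝒩(A)`, the set of degrees of the primes dividing `A`. -/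
def primeDegrees {F : Type*} [Field F] (A : F[X]) : Set ℕ :=
  {d | ∃ P : F[X], IsMonicPrime P ∧ P ∣ A ∧ P.natDegree = d}

/-- `𝒩(A)` is finite for `A ≠ 0`, so that its `Set.ncard` is its number of elements. -/
theorem finite_primeDegrees {F : Type*} [Field F] {A : F[X]} (hA : A ≠ 0) :
    (primeDegrees A).Finite := by
  refine (Set.finite_Iic A.natDegree).subset ?_
  rintro d ⟨P, -, hdvd, rfl⟩
  exact natDegree_le_of_dvd hdvd hA

/-- `Ω(A)`, the number of distinct degrees of primes dividing `A`. -/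
noncomputable def bigOmega {F : Type*} [Field F] (A : F[X]) : ℕ :=
  (primeDegrees A).ncard

/-- `δ₁(A)`, the smallest element of `𝒩(A)`; it is `0` if `𝒩(A)` is empty, since
`sInf ∅ = 0` in `ℕ`. -/
noncomputable def smallestPrimeDegree {F : Type*} [Field F] (A : F[X]) : ℕ :=
  sInf (primeDegrees A)

end FunctionField

/-!
Since exactly `q ^ (x - deg B)` monic polynomials of degree `x` are multiples of a monic `B` of
degree at most `x`, the sum in question is the average, over the monic `A` of degree `x`, of
`g A = ∑ μ(B) Ω(B)`, where `B` runs over the monic divisors of `A` with `δ₁(B) = n`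
(`sum_div_card_pow_eq_average`).

Squarefree monic divisors of `A` are sets of primes dividing `A`, so `g A` is an alternating sum
over such sets. Counting the degrees that occur by indicators and applying inclusion–exclusion,
one finds that `g` is bounded, and that `g A = 0` as soon as primes of two distinct degrees `> n`
divide `A` (`abs_sum_powerset_sInf_eq_le`).

It remains to see that the `A` with at most one prime degree `> n` have density zero
(`tendsto_oneDegreeDensity`). If all primes dividing `A` have the same degree `m ≥ 2`, then `A` is
a product of `x / m` out of at most `q ^ m / m` primes, and the proportion of such `A` is at most
`∑ m ^ (-x / m) ≤ 9 / x`, where `m` runs over the divisors `≥ 2` of `x`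
(`oneDegreeDensity_empty_le`). The finitely many primes of degree `≤ n` are then
allowed one at a time: allowing a prime of degree `d` turns a density `b` into some `v` with
`v (x + d) ≤ b (x + d) + q ^ (-d) * v x`, and this forces `v → 0` if `b → 0`
(`tendsto_zero_of_le_add_mul_shift`).
-/

namespace FunctionField

open scoped Classical Pointwise

variable {F : Type*} [Field F]

/-! ### Counting monic polynomials and primes -/

section Counting

theorem IsMonicPrime.eq_of_dvd {P Q : F[X]} (hP : IsMonicPrime P) (hQ : IsMonicPrime Q)
    (h : P ∣ Q) : P = Q :=
  eq_of_monic_of_associated hP.1 hQ.1 (hP.2.associated_of_dvd hQ.2 h)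

theorem IsMonicPrime.isRelPrime {P Q : F[X]} (hP : IsMonicPrime P) (hQ : IsMonicPrime Q)
    (h : P ≠ Q) : IsRelPrime P Q :=
  (hP.2.coprime_iff_not_dvd.2 fun hd => h (hP.eq_of_dvd hQ hd)).isRelPrime

variable (F) [Fintype F]

theorem finite_monic_natDegree_eq (k : ℕ) : {A : F[X] | A.Monic ∧ A.natDegree = k}.Finite := by
  have : Finite (degreeLT F k) := Finite.of_equiv _ (degreeLTEquiv F k).symm.toEquiv
  exact Set.finite_coe_iff.1 (Finite.of_equiv _ (monicEquivDegreeLT (R := F) k).symm)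

/-- The finite set of monic polynomials of degree `k` over `F`. -/
noncomputable def monicsOfDegree (k : ℕ) : Finset F[X] :=
  (finite_monic_natDegree_eq F k).toFinset

/-- The finite set of primes of degree `m` over `F`. -/
noncomputable def primesOfDegree (m : ℕ) : Finset F[X] :=
  {P ∈ monicsOfDegree F m | Irreducible P}

variable {F}

@[simp]
theorem mem_monicsOfDegree {k : ℕ} {A : F[X]} :
    A ∈ monicsOfDegree F k ↔ A.Monic ∧ A.natDegree = k := by
  simp [monicsOfDegree]

@[simp]
theorem mem_primesOfDegree {m : ℕ} {P : F[X]} :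
    P ∈ primesOfDegree F m ↔ IsMonicPrime P ∧ P.natDegree = m := by
  simp only [primesOfDegree, Finset.mem_filter, mem_monicsOfDegree, IsMonicPrime]
  tauto

@[simp]
theorem mem_monicsUpTo {x : ℕ} {A : F[X]} :
    A ∈ monicsUpTo F x ↔ A.Monic ∧ 1 ≤ A.natDegree ∧ A.natDegree ≤ x := by
  simp [monicsUpTo]

variable (F) in
theorem card_monicsOfDegree (k : ℕ) : (monicsOfDegree F k).card = Fintype.card F ^ k := by
  have e : {A : F[X] // A ∈ monicsOfDegree F k} ≃ (Fin k → F) :=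
    (Equiv.subtypeEquivRight fun _ => mem_monicsOfDegree).trans
      ((monicEquivDegreeLT k).trans (degreeLTEquiv F k).toEquiv)
  rw [← Fintype.card_coe, Fintype.card_congr e]
  simp

theorem card_filter_dvd_monicsOfDegree {B : F[X]} (hB : B.Monic) {x : ℕ} (hx : B.natDegree ≤ x) :
    {A ∈ monicsOfDegree F x | B ∣ A}.card = Fintype.card F ^ (x - B.natDegree) := by
  rw [← card_monicsOfDegree, ← Finset.card_image_of_injective (monicsOfDegree F (x - B.natDegree))
    (mul_right_injective₀ hB.ne_zero)]
  congr 1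
  ext A
  simp only [Finset.mem_filter, mem_monicsOfDegree, Finset.mem_image]
  constructor
  · rintro ⟨⟨hA, rfl⟩, C, rfl⟩
    have hC := hB.of_mul_monic_left hA
    exact ⟨C, ⟨hC, by rw [hB.natDegree_mul hC]; omega⟩, rfl⟩
  · rintro ⟨C, ⟨hC, hd⟩, rfl⟩
    exact ⟨⟨hB.mul hC, by rw [hB.natDegree_mul hC]; omega⟩, dvd_mul_right _ _⟩

/-- The primes of degree `m` are pairwise coprime divisors of `X ^ (q ^ m) - X`, which has
degree `q ^ m`. -/
theorem card_primesOfDegree_mul_le {m : ℕ} (hm : m ≠ 0) :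
    (primesOfDegree F m).card * m ≤ Fintype.card F ^ m := by
  have hq : 1 < Fintype.card F := Fintype.one_lt_card
  have hdvd : ∏ P ∈ primesOfDegree F m, P ∣ X ^ Fintype.card F ^ m - X := by
    refine Finset.prod_dvd_of_isRelPrime (s := fun P => P) ?_ ?_
    · intro P hP Q hQ hne
      exact (mem_primesOfDegree.1 hP).1.isRelPrime (mem_primesOfDegree.1 hQ).1 hne
    · intro P hP
      obtain ⟨hPp, rfl⟩ := mem_primesOfDegree.1 hP
      rw [← Nat.card_eq_fintype_card]
      exact hPp.2.natDegree_dvd_iff_dvd_X_pow_card_pow_sub_X.1 dvd_rfl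
  have hle := natDegree_le_of_dvd hdvd (FiniteField.X_pow_card_pow_sub_X_ne_zero F hm hq)
  rw [FiniteField.X_pow_card_pow_sub_X_natDegree_eq F hm hq,
    natDegree_prod_of_monic _ _ fun P hP => (mem_primesOfDegree.1 hP).1.1,
    Finset.sum_const_nat fun P hP => (mem_primesOfDegree.1 hP).2] at hle
  exact hle

/-- A sum of `f(B) / q ^ deg B` over monic `B` of degree at most `x` is an average over the monic
`A` of degree `x`, because exactly `q ^ (x - deg B)` of them are multiples of `B`. -/
theorem sum_div_card_pow_eq_average (f : F[X] → ℝ) (x : ℕ) (p : F[X] → Prop)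
    [DecidablePred p] :
    ∑ B ∈ monicsUpTo F x with p B, f B / (Fintype.card F : ℝ) ^ B.natDegree =
      (∑ A ∈ monicsOfDegree F x, ∑ B ∈ monicsUpTo F x with p B ∧ B ∣ A, f B) /
        (Fintype.card F : ℝ) ^ x := by
  have hq : (Fintype.card F : ℝ) ≠ 0 := Nat.cast_ne_zero.2 Fintype.card_ne_zero
  simp_rw [← Finset.filter_filter]
  simp_rw [fun A : F[X] => Finset.sum_filter (s := {B ∈ monicsUpTo F x | p B}) (· ∣ A) f]
  rw [Finset.sum_comm, Finset.sum_div]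
  refine Finset.sum_congr rfl fun B hB => ?_
  obtain ⟨hm, -, hd⟩ := mem_monicsUpTo.1 (Finset.mem_filter.1 hB).1
  rw [← Finset.sum_filter, Finset.sum_const, card_filter_dvd_monicsOfDegree hm hd, nsmul_eq_mul]
  push_cast
  rw [div_eq_div_iff (pow_ne_zero _ hq) (pow_ne_zero _ hq), mul_right_comm, ← pow_add,
    Nat.sub_add_cancel hd, mul_comm]

end Counting

/-! ### Squarefree divisors and subsets of the prime factors -/

section Divisors

open UniqueFactorizationMonoid

theorem mem_primeFactors_iff {A P : F[X]} (hA : A ≠ 0) :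
    P ∈ primeFactors A ↔ IsMonicPrime P ∧ P ∣ A := by
  rw [mem_primeFactors, mem_normalizedFactors_iff' hA, IsMonicPrime]
  constructor
  · rintro ⟨h1, h2, h3⟩
    exact ⟨⟨(normalize_eq_self_iff_monic h1.ne_zero).1 h2, h1⟩, h3⟩
  · rintro ⟨⟨h1, h2⟩, h3⟩
    exact ⟨h2, (normalize_eq_self_iff_monic h2.ne_zero).2 h1, h3⟩

theorem primeDegrees_eq_image {A : F[X]} (hA : A ≠ 0) :
    primeDegrees A = ((primeFactors A).image natDegree : Finset ℕ) := by
  ext d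
  simp [primeDegrees, mem_primeFactors_iff hA, and_assoc]

theorem primeFactors_prod {s : Finset F[X]} (hs : ∀ P ∈ s, IsMonicPrime P) :
    primeFactors (∏ P ∈ s, P) = s := by
  have h0 : ∏ P ∈ s, P ≠ 0 := (monic_prod_of_monic _ _ fun P hP => (hs P hP).1).ne_zero
  ext P
  rw [mem_primeFactors_iff h0]
  constructor
  · rintro ⟨hP, hd⟩
    obtain ⟨Q, hQ, hPQ⟩ := (hP.2.prime.dvd_finsetProd_iff _).1 hd
    rwa [hP.eq_of_dvd (hs Q hQ) hPQ]
  · exact fun hP => ⟨hs P hP, Finset.dvd_prod_of_mem _ hP⟩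

theorem squarefree_prod {s : Finset F[X]} (hs : ∀ P ∈ s, IsMonicPrime P) :
    Squarefree (∏ P ∈ s, P) :=
  Finset.squarefree_prod_of_pairwise_isCoprime
    (fun P hP Q hQ hne => (hs P hP).isRelPrime (hs Q hQ) hne) fun P hP => (hs P hP).2.squarefree

theorem prod_primeFactors_eq_self {B : F[X]} (hB : B.Monic) (hsq : Squarefree B) :
    ∏ P ∈ primeFactors B, P = B :=
  eq_of_monic_of_associated
    (monic_prod_of_monic _ _ fun _ hP => ((mem_primeFactors_iff hB.ne_zero).1 hP).1.1) hB
    (radical_associated hsq.isRadical hB.ne_zero)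

theorem moebius_eq_neg_one_pow_card_primeFactors {B : F[X]} (hsq : Squarefree B) :
    moebius B = (-1) ^ (primeFactors B).card := by
  rw [hsq.moebius_eq, Finset.card_def, primeFactors_val_eq_normalizedFactors hsq.isRadical,
    normalizedFactors, Multiset.card_map]

/-- Only squarefree divisors `B` of `A` contribute, and those correspond to the sets of primes
dividing `A`. The empty set, i.e. `B = 1`, is excluded on both sides by `n ≠ 0`. -/
theorem sum_moebius_mul_bigOmega_dvd [Fintype F] {n x : ℕ} (hn : n ≠ 0) {A : F[X]}
    (hA : A ∈ monicsOfDegree F x) :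
    ∑ B ∈ monicsUpTo F x with smallestPrimeDegree B = n ∧ B ∣ A,
        moebius B * (bigOmega B : ℤ) =
      ∑ s ∈ (primeFactors A).powerset with sInf (s.image natDegree : Set ℕ) = n,
        (-1) ^ s.card * ((s.image natDegree).card : ℤ) := by
  obtain ⟨hAm, hAx⟩ := mem_monicsOfDegree.1 hA
  have hsub : ∀ s ∈ (primeFactors A).powerset, ∀ P ∈ s, IsMonicPrime P := fun s hs P hP =>
    ((mem_primeFactors_iff hAm.ne_zero).1 (Finset.mem_powerset.1 hs hP)).1
  rw [← Finset.sum_filter_of_ne (p := Squarefree) fun B _ h => by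
    by_contra hB; simp [hB] at h]
  refine Finset.sum_bij' (fun B _ => primeFactors B) (fun s _ => ∏ P ∈ s, P) ?_ ?_ ?_ ?_ ?_
  · intro B hB
    simp only [Finset.mem_filter, mem_monicsUpTo] at hB
    obtain ⟨⟨⟨hm, -, -⟩, hδ, hd⟩, -⟩ := hB
    rw [Finset.mem_filter, Finset.mem_powerset,
      ← primeDegrees_eq_image hm.ne_zero]
    refine ⟨fun P hP => ?_, hδ⟩
    rw [mem_primeFactors_iff hm.ne_zero] at hP
    exact (mem_primeFactors_iff hAm.ne_zero).2 ⟨hP.1, hP.2.trans hd⟩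
  · intro s hs
    rw [Finset.mem_filter] at hs
    have hp := hsub s hs.1
    have hm : (∏ P ∈ s, P).Monic := monic_prod_of_monic _ _ fun P hP => (hp P hP).1
    have hδ : smallestPrimeDegree (∏ P ∈ s, P) = n := by
      rw [smallestPrimeDegree, primeDegrees_eq_image hm.ne_zero, primeFactors_prod hp]
      exact_mod_cast hs.2
    have hd : ∏ P ∈ s, P ∣ A :=
      Finset.prod_dvd_of_isRelPrime (s := fun P => P)
        (fun P hP Q hQ hne => (hp P hP).isRelPrime (hp Q hQ) hne) fun P hP =>
          ((mem_primeFactors_iff hAm.ne_zero).1 (Finset.mem_powerset.1 hs.1 hP)).2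
    have h1 : (∏ P ∈ s, P).natDegree ≠ 0 := by
      intro h0
      have hs0 : s = ∅ := by
        rw [← primeFactors_prod hp, hm.natDegree_eq_zero.1 h0, primeFactors_one]
      apply hn
      rw [← hs.2, hs0]
      simp
    simp only [Finset.mem_filter, mem_monicsUpTo]
    exact ⟨⟨⟨hm, Nat.one_le_iff_ne_zero.2 h1, hAx ▸ natDegree_le_of_dvd hd hAm.ne_zero⟩, hδ, hd⟩,
      squarefree_prod hp⟩
  · intro B hB
    simp only [Finset.mem_filter, mem_monicsUpTo] at hB
    exact prod_primeFactors_eq_self hB.1.1.1 hB.2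
  · intro s hs
    exact primeFactors_prod (hsub s (Finset.mem_filter.1 hs).1)
  · intro B hB
    simp only [Finset.mem_filter, mem_monicsUpTo] at hB
    rw [moebius_eq_neg_one_pow_card_primeFactors hB.2, bigOmega,
      primeDegrees_eq_image hB.1.1.1.ne_zero, Set.ncard_coe_finset]

end Divisors

/-! ### Inclusion–exclusion over sets of primes -/

section InclusionExclusion

variable {α : Type*}

theorem sum_powerset_neg_one_pow_card_forall (U : Finset α) (p : α → Prop)
    [DecidablePred p] :
    ∑ s ∈ U.powerset, (-1 : ℤ) ^ s.card * (if ∀ a ∈ s, p a then 1 else 0) =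
      if ∀ a ∈ U, ¬ p a then 1 else 0 := by
  simp_rw [mul_ite, mul_one, mul_zero]
  rw [← Finset.sum_filter]
  have h : {s ∈ U.powerset | ∀ a ∈ s, p a} = (U.filter p).powerset := by
    ext s
    simp only [Finset.mem_filter, Finset.mem_powerset, Finset.subset_iff]
    grind
  rw [h, Finset.sum_powerset_neg_one_pow_card]
  simp only [Finset.filter_eq_empty_iff]

/-- The weight `Ω 1_{δ₁ = n}` of a set `s`, as a sum over the degrees `m` of the indicator that `s`
has no degree below `n` but has the degrees `n` and `m`. The indicator is expanded by
inclusion–exclusion into indicators that certain degrees do not occur in `s`, which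
`sum_powerset_neg_one_pow_card_forall` can evaluate. -/
theorem card_image_eq_sum_of_sInf_eq (deg : α → ℕ) {n : ℕ} (hn : n ≠ 0) {U s : Finset α}
    (hs : s ⊆ U) :
    (if sInf (s.image deg : Set ℕ) = n then ((s.image deg).card : ℤ) else 0) =
      ∑ m ∈ (U.image deg).filter (n ≤ ·),
        (((if ∀ a ∈ s, n ≤ deg a then 1 else 0) - (if ∀ a ∈ s, n < deg a then 1 else 0)) -
          ((if ∀ a ∈ s, n ≤ deg a ∧ deg a ≠ m then 1 else 0) -
            (if ∀ a ∈ s, n < deg a ∧ deg a ≠ m then 1 else 0))) := by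
  by_cases h : sInf (s.image deg : Set ℕ) = n
  · rw [if_pos h]
    have hne : (s.image deg).Nonempty := by
      by_contra h0
      rw [Finset.not_nonempty_iff_eq_empty] at h0
      rw [h0] at h
      simp at h
      omega
    have hmin : ∀ a ∈ s, n ≤ deg a := fun a ha =>
      h ▸ Nat.sInf_le (Finset.mem_coe.2 (Finset.mem_image_of_mem deg ha))
    have hmem : ∃ a ∈ s, deg a = n := by
      have := Nat.sInf_mem (s := (s.image deg : Set ℕ)) (by exact_mod_cast hne)
      rw [h] at this
      simpa using this
    obtain ⟨a, ha, han⟩ := hmem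
    have hsub : s.image deg ⊆ (U.image deg).filter (n ≤ ·) := by
      intro m hm
      obtain ⟨b, hb, rfl⟩ := Finset.mem_image.1 hm
      exact Finset.mem_filter.2 ⟨Finset.mem_image_of_mem _ (hs hb), hmin b hb⟩
    rw [Finset.cast_card, ← Finset.sum_subset hsub]
    · refine Finset.sum_congr rfl fun m hm => ?_
      obtain ⟨b, hb, rfl⟩ := Finset.mem_image.1 hm
      rw [if_pos hmin, if_neg fun H => (H a ha).ne' han, if_neg fun H => (H b hb).2 rfl,
        if_neg fun H => (H b hb).2 rfl]
      norm_num
    · intro m _ hm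
      have hm' : ∀ a ∈ s, deg a ≠ m := fun b hb hbm => hm (hbm ▸ Finset.mem_image_of_mem _ hb)
      rw [if_pos hmin, if_neg fun H => (H a ha).ne' han,
        if_pos fun b hb => ⟨hmin b hb, hm' b hb⟩, if_neg fun H => (H a ha).1.ne' han]
      norm_num
  · rw [if_neg h]
    symm
    refine Finset.sum_eq_zero fun m _ => ?_
    by_cases h1 : ∀ a ∈ s, n ≤ deg a
    · have h2 : ∀ a ∈ s, n < deg a := by
        intro a ha
        refine lt_of_le_of_ne (h1 a ha) fun hna => h ?_
        have hmem : n ∈ (s.image deg : Set ℕ) :=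
          Finset.mem_coe.2 (Finset.mem_image.2 ⟨a, ha, hna.symm⟩)
        refine le_antisymm (Nat.sInf_le hmem) (le_csInf ⟨n, hmem⟩ fun m hm => ?_)
        obtain ⟨b, hb, rfl⟩ := Finset.mem_image.1 (Finset.mem_coe.1 hm)
        exact h1 b hb
      have h3 : (∀ a ∈ s, n ≤ deg a ∧ deg a ≠ m) ↔ ∀ a ∈ s, n < deg a ∧ deg a ≠ m :=
        forall₂_congr fun a ha => by simp [h1 a ha, h2 a ha]
      simp [if_pos h1, if_pos h2, h3]
    · have h2 : ¬ ∀ a ∈ s, n < deg a := fun H => h1 fun a ha => (H a ha).le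
      rw [if_neg h1, if_neg h2, if_neg fun H => h1 fun a ha => (H a ha).1,
        if_neg fun H => h2 fun a ha => (H a ha).1]
      norm_num

/-- Two distinct degrees `> n` make all four alternating sums attached to each degree `m` vanish;
otherwise at most two degrees `m` contribute, by at most `2` each. -/
theorem abs_sum_powerset_sInf_eq_le (U : Finset α) (deg : α → ℕ) {n : ℕ} (hn : n ≠ 0) :
    |∑ s ∈ U.powerset with sInf (s.image deg : Set ℕ) = n,
        (-1 : ℤ) ^ s.card * ((s.image deg).card : ℤ)| ≤
      if ∃ m > n, ∀ a ∈ U, deg a ≤ n ∨ deg a = m then 4 else 0 := by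
  set M := (U.image deg).filter (n ≤ ·) with hM
  have key : ∑ s ∈ U.powerset with sInf (s.image deg : Set ℕ) = n,
        (-1 : ℤ) ^ s.card * ((s.image deg).card : ℤ) =
      ∑ m ∈ M, (((if ∀ a ∈ U, ¬ n ≤ deg a then 1 else 0) -
          (if ∀ a ∈ U, ¬ n < deg a then 1 else 0)) -
        ((if ∀ a ∈ U, ¬ (n ≤ deg a ∧ deg a ≠ m) then 1 else 0) -
          (if ∀ a ∈ U, ¬ (n < deg a ∧ deg a ≠ m) then 1 else 0))) := by
    have hterm : ∀ s ∈ U.powerset,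
        (if sInf (s.image deg : Set ℕ) = n then (-1 : ℤ) ^ s.card * ((s.image deg).card : ℤ)
          else 0) = _ := fun s hs => by
      rw [← mul_ite_zero, card_image_eq_sum_of_sInf_eq deg hn (Finset.mem_powerset.1 hs),
        Finset.mul_sum]
    rw [Finset.sum_filter, Finset.sum_congr rfl hterm, Finset.sum_comm]
    refine Finset.sum_congr rfl fun m _ => ?_
    rw [← sum_powerset_neg_one_pow_card_forall U (fun a => n ≤ deg a),
      ← sum_powerset_neg_one_pow_card_forall U (fun a => n < deg a),
      ← sum_powerset_neg_one_pow_card_forall U (fun a => n ≤ deg a ∧ deg a ≠ m),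
      ← sum_powerset_neg_one_pow_card_forall U (fun a => n < deg a ∧ deg a ≠ m)]
    simp_rw [← Finset.sum_sub_distrib, ← mul_sub]
  rw [key]
  by_cases h : ∃ m > n, ∀ a ∈ U, deg a ≤ n ∨ deg a = m
  · rw [if_pos h]
    obtain ⟨m₀, hm₀, hU⟩ := h
    have hMsub : M ⊆ {n, m₀} := by
      intro m hm
      obtain ⟨hm1, hm2⟩ := Finset.mem_filter.1 hm
      obtain ⟨a, ha, rfl⟩ := Finset.mem_image.1 hm1
      have := hU a ha
      simp only [Finset.mem_insert, Finset.mem_singleton]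
      omega
    have hcard : M.card ≤ 2 := (Finset.card_le_card hMsub).trans Finset.card_le_two
    refine (Finset.abs_sum_le_sum_abs _ _).trans
      ((Finset.sum_le_card_nsmul _ _ 2 fun m _ => ?_).trans ?_)
    · split_ifs <;> norm_num
    · rw [nsmul_eq_mul]
      have : (M.card : ℤ) ≤ 2 := by exact_mod_cast hcard
      linarith
  · rw [if_neg h]
    push Not at h
    rw [abs_nonpos_iff]
    refine Finset.sum_eq_zero fun m _ => ?_
    obtain ⟨a, ha, han, ham⟩ : ∃ a ∈ U, n < deg a ∧ deg a ≠ m := by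
      obtain ⟨b, hb, hbn, -⟩ := h (n + 1) (Nat.lt_succ_self n)
      by_cases hbm : deg b = m
      · exact hbm ▸ h (deg b) hbn
      · exact ⟨b, hb, hbn, hbm⟩
    rw [if_neg fun H => H a ha han.le, if_neg fun H => H a ha han,
      if_neg fun H => H a ha ⟨han.le, ham⟩, if_neg fun H => H a ha ⟨han, ham⟩]
    norm_num

end InclusionExclusion

/-! ### Polynomials with at most one prime degree above `n` have density zero -/

section Density

open Filter Topology

/-- Every prime factor of `A` lies in `S`, except for primes of one common degree `m > n`. There
need not be any exception; then every `m > n` will do. -/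
def HasAtMostOneDegreeOutside (S : Finset F[X]) (n : ℕ) (A : F[X]) : Prop :=
  ∃ m > n, ∀ P, IsMonicPrime P → P ∣ A → P ∈ S ∨ P.natDegree = m

/-- The proportion of the monic polynomials of degree `x` satisfying
`HasAtMostOneDegreeOutside S n`. -/
noncomputable def oneDegreeDensity [Fintype F] (S : Finset F[X]) (n x : ℕ) : ℝ :=
  ({A ∈ monicsOfDegree F x | HasAtMostOneDegreeOutside S n A}.card : ℝ) / (Fintype.card F : ℝ) ^ x

theorem mem_primesOfDegree_pow [Fintype F] {m : ℕ} (hm : m ≠ 0) : ∀ (j : ℕ) {A : F[X]}, A.Monic →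
    A.natDegree = m * j → (∀ P, IsMonicPrime P → P ∣ A → P.natDegree = m) →
      A ∈ primesOfDegree F m ^ j
  | 0, A, hA, hd, _ => by
    rw [mul_zero] at hd
    simp [hA.natDegree_eq_zero.1 hd]
  | j + 1, A, hA, hd, hP => by
    have hu : ¬ IsUnit A := fun hu => by
      rw [natDegree_eq_zero_of_isUnit hu, eq_comm, mul_eq_zero] at hd
      exact hd.elim hm (Nat.succ_ne_zero j)
    obtain ⟨P, hPm, hPi, B, rfl⟩ := A.exists_monic_irreducible_factor hu
    have hPd := hP P ⟨hPm, hPi⟩ (dvd_mul_right _ _)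
    have hB := hPm.of_mul_monic_left hA
    rw [hPm.natDegree_mul hB, hPd, mul_add, mul_one, add_comm, Nat.add_right_cancel_iff] at hd
    rw [pow_succ']
    exact Finset.mul_mem_mul (mem_primesOfDegree.2 ⟨⟨hPm, hPi⟩, hPd⟩)
      (mem_primesOfDegree_pow hm j hB hd fun Q hQ hQB => hP Q hQ (hQB.mul_left _))

/-- Removing one prime factor lowers the degree by `m`. -/
theorem dvd_natDegree_of_forall_prime {m : ℕ} {A : F[X]} (hA : A.Monic)
    (hP : ∀ P, IsMonicPrime P → P ∣ A → P.natDegree = m) : m ∣ A.natDegree := by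
  induction h : A.natDegree using Nat.strong_induction_on generalizing A with
  | _ k ih =>
    by_cases hu : IsUnit A
    · rw [← h, natDegree_eq_zero_of_isUnit hu]
      exact dvd_zero m
    · obtain ⟨P, hPm, hPi, B, rfl⟩ := A.exists_monic_irreducible_factor hu
      have hB := hPm.of_mul_monic_left hA
      have hPd := hP P ⟨hPm, hPi⟩ (dvd_mul_right _ _)
      have hpos := hPi.natDegree_pos
      rw [hPm.natDegree_mul hB] at h
      rw [← h, hPd]
      exact (dvd_refl m).add (ih _ (by omega) hB
        (fun Q hQ hQB => hP Q hQ (hQB.mul_left _)) rfl)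

theorem sq_mul_le_eight_mul_pow {m j : ℕ} (hm : 2 ≤ m) (hj : 2 ≤ j) :
    (m * j) ^ 2 ≤ 8 * m ^ j := by
  obtain ⟨i, rfl⟩ := Nat.exists_eq_add_of_le' hj
  -- The `+ 1` is what the step from `i = 0` to `i = 1` needs: `9 ≤ 2 * 4` fails.
  have h : ∀ i : ℕ, (i + 2) ^ 2 + 1 ≤ 8 * 2 ^ i := by
    intro i
    induction i with
    | zero => norm_num
    | succ i ih => rw [pow_succ 2 i]; nlinarith [Nat.zero_le (i ^ 2), Nat.zero_le i]
  have h2 : (i + 2) ^ 2 ≤ 8 * m ^ i :=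
    ((Nat.le_succ _).trans (h i)).trans (Nat.mul_le_mul_left 8 (Nat.pow_le_pow_left hm i))
  calc (m * (i + 2)) ^ 2 = m ^ 2 * (i + 2) ^ 2 := by ring
    _ ≤ m ^ 2 * (8 * m ^ i) := Nat.mul_le_mul_left _ h2
    _ = 8 * m ^ (i + 2) := by ring

/-- A polynomial of degree `x` all of whose primes have degree `m` is a product of `x / m` of the
at most `q ^ m / m` primes of degree `m`, so the proportion of such polynomials is at most
`m ^ (-x / m)`. Over the divisors `m ≥ 2` of `x` these add up to at most
`1 / x + x * (8 / x ^ 2)`. -/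
theorem oneDegreeDensity_empty_le [Fintype F] {n : ℕ} (hn : 1 ≤ n) {x : ℕ} (hx : x ≠ 0) :
    oneDegreeDensity (∅ : Finset F[X]) n x ≤ 9 / x := by
  set D := {m ∈ x.divisors | 2 ≤ m} with hD
  have hx0 : (0 : ℝ) < x := by positivity
  have hq : (0 : ℝ) < Fintype.card F := by exact_mod_cast Fintype.card_pos
  have hsub : {A ∈ monicsOfDegree F x | HasAtMostOneDegreeOutside ∅ n A} ⊆
      D.biUnion fun m => primesOfDegree F m ^ (x / m) := by
    intro A hA
    rw [Finset.mem_filter, mem_monicsOfDegree] at hA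
    obtain ⟨⟨hAm, hAx⟩, m, hm, hP⟩ := hA
    replace hP : ∀ P, IsMonicPrime P → P ∣ A → P.natDegree = m := by simpa using hP
    have hmx : m ∣ x := hAx ▸ dvd_natDegree_of_forall_prime hAm hP
    refine Finset.mem_biUnion.2 ⟨m, Finset.mem_filter.2
      ⟨Nat.mem_divisors.2 ⟨hmx, hx⟩, by omega⟩, ?_⟩
    exact mem_primesOfDegree_pow (by omega) _ hAm (by rw [hAx, Nat.mul_div_cancel' hmx]) hP
  have hterm : ∀ m ∈ D, ((primesOfDegree F m ^ (x / m)).card : ℝ) / (Fintype.card F : ℝ) ^ x ≤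
      (if m = x then 1 / (x : ℝ) else 0) + 8 / (x : ℝ) ^ 2 := by
    intro m hm
    obtain ⟨hmx, hm2⟩ := Finset.mem_filter.1 hm
    obtain ⟨j, rfl⟩ := (Nat.mem_divisors.1 hmx).1
    have hm0 : m ≠ 0 := by omega
    rw [Nat.mul_div_cancel_left j (Nat.pos_of_ne_zero hm0)]
    have hmR : (0 : ℝ) < m := by positivity
    have h1 : ((primesOfDegree F m).card : ℝ) ≤ (Fintype.card F : ℝ) ^ m / m := by
      rw [le_div_iff₀ hmR]
      exact_mod_cast card_primesOfDegree_mul_le (F := F) hm0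
    have h2 : ((primesOfDegree F m ^ j).card : ℝ) / (Fintype.card F : ℝ) ^ (m * j) ≤
        1 / (m : ℝ) ^ j := by
      rw [div_le_iff₀ (by positivity)]
      calc ((primesOfDegree F m ^ j).card : ℝ) ≤ ((primesOfDegree F m).card : ℝ) ^ j := by
            exact_mod_cast Finset.card_pow_le
        _ ≤ ((Fintype.card F : ℝ) ^ m / m) ^ j := by gcongr
        _ = 1 / (m : ℝ) ^ j * (Fintype.card F : ℝ) ^ (m * j) := by
            rw [div_pow, pow_mul]; ring
    refine h2.trans ?_
    have hj0 : j ≠ 0 := by rintro rfl; simp at hx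
    rcases eq_or_ne j 1 with rfl | hj1
    · rw [mul_one, if_pos rfl, pow_one]
      have : (0 : ℝ) ≤ 8 / (m : ℝ) ^ 2 := by positivity
      linarith
    · have hle : ((m * j : ℕ) : ℝ) ^ 2 ≤ 8 * (m : ℝ) ^ j := by
        exact_mod_cast sq_mul_le_eight_mul_pow hm2 (by omega : 2 ≤ j)
      have h3 : 1 / (m : ℝ) ^ j ≤ 8 / ((m * j : ℕ) : ℝ) ^ 2 := by
        rw [div_le_div_iff₀ (by positivity) (by positivity)]
        linarith
      refine h3.trans (le_add_of_nonneg_left ?_)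
      split_ifs <;> positivity
  have hcard : (D.card : ℝ) ≤ x := by
    exact_mod_cast (Finset.card_filter_le _ _).trans (Nat.card_divisors_le_self x)
  calc oneDegreeDensity (∅ : Finset F[X]) n x
      ≤ (∑ m ∈ D, ((primesOfDegree F m ^ (x / m)).card : ℝ)) / (Fintype.card F : ℝ) ^ x := by
        rw [oneDegreeDensity]
        gcongr
        exact_mod_cast (Finset.card_le_card hsub).trans Finset.card_biUnion_le
    _ ≤ ∑ m ∈ D, ((if m = x then 1 / (x : ℝ) else 0) + 8 / (x : ℝ) ^ 2) := by
        rw [Finset.sum_div]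
        exact Finset.sum_le_sum hterm
    _ ≤ 1 / x + x * (8 / (x : ℝ) ^ 2) := by
        rw [Finset.sum_add_distrib, Finset.sum_ite_eq', Finset.sum_const, nsmul_eq_mul]
        gcongr
        split_ifs
        · exact le_rfl
        · positivity
    _ = 9 / x := by field_simp; norm_num

/-- Sorting the polynomials by divisibility by the additional prime `P`. -/
theorem oneDegreeDensity_insert_le [Fintype F] (S : Finset F[X]) (n : ℕ) {P : F[X]}
    (hP : IsMonicPrime P) (x : ℕ) :
    oneDegreeDensity (insert P S) n (x + P.natDegree) ≤
      oneDegreeDensity S n (x + P.natDegree) +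
        ((Fintype.card F : ℝ) ^ P.natDegree)⁻¹ * oneDegreeDensity (insert P S) n x := by
  have hq : (0 : ℝ) < Fintype.card F := by exact_mod_cast Fintype.card_pos
  have hsub : {A ∈ monicsOfDegree F (x + P.natDegree) |
        HasAtMostOneDegreeOutside (insert P S) n A} ⊆
      {A ∈ monicsOfDegree F (x + P.natDegree) | HasAtMostOneDegreeOutside S n A} ∪
        {A ∈ monicsOfDegree F x | HasAtMostOneDegreeOutside (insert P S) n A}.image (P * ·) := by
    intro A hA
    rw [Finset.mem_filter, mem_monicsOfDegree] at hA
    obtain ⟨⟨hAm, hAx⟩, m, hm, hA⟩ := hA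
    rw [Finset.mem_union]
    by_cases hd : P ∣ A
    · right
      obtain ⟨B, rfl⟩ := hd
      have hB := hP.1.of_mul_monic_left hAm
      rw [hP.1.natDegree_mul hB] at hAx
      refine Finset.mem_image_of_mem _ (Finset.mem_filter.2
        ⟨mem_monicsOfDegree.2 ⟨hB, by omega⟩, m, hm, fun Q hQ hQB => hA Q hQ (hQB.mul_left _)⟩)
    · left
      refine Finset.mem_filter.2 ⟨mem_monicsOfDegree.2 ⟨hAm, hAx⟩, m, hm, fun Q hQ hQA => ?_⟩
      refine (hA Q hQ hQA).imp_left fun h => Finset.mem_of_mem_insert_of_ne h ?_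
      rintro rfl
      exact hd hQA
  have hcard := (Finset.card_le_card hsub).trans
    ((Finset.card_union_le _ _).trans (Nat.add_le_add_left Finset.card_image_le _))
  rw [oneDegreeDensity, oneDegreeDensity, oneDegreeDensity, inv_mul_eq_div, div_div, ← pow_add,
    ← add_div]
  gcongr
  exact_mod_cast hcard

theorem oneDegreeDensity_nonneg [Fintype F] (S : Finset F[X]) (n x : ℕ) :
    0 ≤ oneDegreeDensity S n x := by
  unfold oneDegreeDensity
  positivity

theorem oneDegreeDensity_le_one [Fintype F] (S : Finset F[X]) (n x : ℕ) :
    oneDegreeDensity S n x ≤ 1 := by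
  refine div_le_one_of_le₀ ?_ (by positivity)
  exact_mod_cast (Finset.card_filter_le _ _).trans (card_monicsOfDegree F x).le

/-- Once `b ≤ (1 - θ) * ε / 2`, iterating the inequality `i` times gives `v ≤ ε / 2 + θ ^ i`. -/
theorem tendsto_zero_of_le_add_mul_shift {v b : ℕ → ℝ} {d : ℕ} {θ : ℝ} (hθ0 : 0 ≤ θ) (hθ : θ < 1)
    (hv0 : ∀ x, 0 ≤ v x) (hv1 : ∀ x, v x ≤ 1) (hb : Tendsto b atTop (𝓝 0))
    (h : ∀ x, v (x + d) ≤ b (x + d) + θ * v x) : Tendsto v atTop (𝓝 0) := by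
  rw [Metric.tendsto_atTop]
  intro ε hε
  obtain ⟨N, hN⟩ := (Metric.tendsto_atTop.1 hb) ((1 - θ) * (ε / 2))
    (mul_pos (by linarith) (by linarith))
  have hiter : ∀ i x, N + i * d ≤ x → v x ≤ ε / 2 + θ ^ i := by
    intro i
    induction i with
    | zero => intro x _; have := hv1 x; simp; linarith
    | succ i ih =>
      intro x hx
      obtain ⟨y, rfl⟩ := Nat.exists_eq_add_of_le' (show d ≤ x by nlinarith)
      have hby := (abs_lt.1 (by simpa [Real.dist_eq] using hN (y + d) (by nlinarith))).2
      have hvy := mul_le_mul_of_nonneg_left (ih y (by linarith)) hθ0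
      rw [pow_succ']
      linarith [h y]
  obtain ⟨i, hi⟩ := exists_pow_lt_of_lt_one (half_pos hε) hθ
  refine ⟨N + i * d, fun x hx => ?_⟩
  rw [Real.dist_eq, sub_zero, abs_of_nonneg (hv0 x)]
  linarith [hiter i x hx]

theorem tendsto_oneDegreeDensity [Fintype F] {n : ℕ} (hn : 1 ≤ n) (S : Finset F[X])
    (hS : ∀ P ∈ S, IsMonicPrime P) : Tendsto (oneDegreeDensity S n) atTop (𝓝 0) := by
  induction S using Finset.induction_on with
  | empty =>
    refine squeeze_zero' (Eventually.of_forall fun x => oneDegreeDensity_nonneg _ _ _)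
      ((eventually_ne_atTop 0).mono fun x hx => oneDegreeDensity_empty_le hn hx)
      (tendsto_const_div_atTop_nhds_zero_nat 9)
  | insert P S _ ih =>
    have hP := hS P (Finset.mem_insert_self _ _)
    refine tendsto_zero_of_le_add_mul_shift (by positivity) (inv_lt_one_of_one_lt₀ ?_)
      (oneDegreeDensity_nonneg _ _) (oneDegreeDensity_le_one _ _)
      (ih fun Q hQ => hS Q (Finset.mem_insert_of_mem hQ)) (oneDegreeDensity_insert_le S n hP)
    exact one_lt_pow₀ (by exact_mod_cast Fintype.one_lt_card) hP.2.natDegree_pos.ne'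

end Density

/-! ### The divisor sum of `μ Ω` over `δ₁ = n` -/

section Average

/-- The Dirichlet convolution of `μ Ω 1_{δ₁ = n}` with `1` is bounded by `4`, and vanishes at `A`
if two distinct degrees above `n` occur among the primes dividing `A`. -/
theorem abs_sum_moebius_mul_bigOmega_dvd_le [Fintype F] {n x : ℕ} (hn : n ≠ 0) {A : F[X]}
    (hA : A ∈ monicsOfDegree F x) :
    |∑ B ∈ monicsUpTo F x with smallestPrimeDegree B = n ∧ B ∣ A,
        UniqueFactorizationMonoid.moebius B * (bigOmega B : ℤ)| ≤
      if HasAtMostOneDegreeOutside ((Finset.Icc 1 n).biUnion (primesOfDegree F)) n A then 4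
      else 0 := by
  have hA0 := (mem_monicsOfDegree.1 hA).1.ne_zero
  rw [sum_moebius_mul_bigOmega_dvd hn hA]
  convert abs_sum_powerset_sInf_eq_le (UniqueFactorizationMonoid.primeFactors A) natDegree hn
    using 1
  refine if_congr (exists_congr fun m => and_congr_right fun _ => forall_congr' fun P => ?_) rfl rfl
  rw [mem_primeFactors_iff hA0, and_imp]
  refine forall₂_congr fun hP _ => or_congr_left ?_
  simp only [Finset.mem_biUnion, Finset.mem_Icc, mem_primesOfDegree]
  exact ⟨fun ⟨d, hd, _, h⟩ => h ▸ hd.2, fun h => ⟨_, ⟨hP.2.natDegree_pos, h⟩, hP, rfl⟩⟩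

theorem abs_sum_moebius_mul_bigOmega_div_le [Fintype F] {n : ℕ} (hn : n ≠ 0) (x : ℕ) :
    |∑ B ∈ monicsUpTo F x with smallestPrimeDegree B = n,
        (UniqueFactorizationMonoid.moebius B : ℝ) * (bigOmega B : ℝ) /
          (Fintype.card F : ℝ) ^ B.natDegree| ≤
      4 * oneDegreeDensity ((Finset.Icc 1 n).biUnion (primesOfDegree F)) n x := by
  rw [sum_div_card_pow_eq_average
      (fun B => (UniqueFactorizationMonoid.moebius B : ℝ) * (bigOmega B : ℝ)), abs_div,
    abs_of_nonneg (by positivity : (0 : ℝ) ≤ _ ^ x),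
    oneDegreeDensity, ← mul_div_assoc]
  gcongr
  calc _ ≤ ∑ A ∈ monicsOfDegree F x,
        (if HasAtMostOneDegreeOutside ((Finset.Icc 1 n).biUnion (primesOfDegree F)) n A
          then (4 : ℝ) else 0) := by
        refine (Finset.abs_sum_le_sum_abs _ _).trans (Finset.sum_le_sum fun A hA => ?_)
        exact_mod_cast abs_sum_moebius_mul_bigOmega_dvd_le hn hA
    _ = _ := by
        rw [← Finset.sum_filter, Finset.sum_const, nsmul_eq_mul, mul_comm]

end Average

end FunctionField

theorem mainTheorem5 (F : Type*) [Field F] [Fintype F] (n : ℕ) (hn : 1 ≤ n) :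
    Filter.Tendsto
      (fun x : ℕ =>
        ∑ A ∈ FunctionField.monicsUpTo F x with FunctionField.smallestPrimeDegree A = n,
          (UniqueFactorizationMonoid.moebius A : ℝ) * (FunctionField.bigOmega A : ℝ)
            / (Fintype.card F : ℝ) ^ A.natDegree)
      Filter.atTop (nhds 0) := by
  classical
  have h := FunctionField.tendsto_oneDegreeDensity (F := F) hn
    ((Finset.Icc 1 n).biUnion (FunctionField.primesOfDegree F)) fun P hP => by
      obtain ⟨d, -, hd⟩ := Finset.mem_biUnion.1 hP
      exact (FunctionField.mem_primesOfDegree.1 hd).1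
  refine squeeze_zero_norm (fun x => ?_) (by simpa using h.const_mul 4)
  simpa only [Real.norm_eq_abs] using
    FunctionField.abs_sum_moebius_mul_bigOmega_div_le (F := F) (by omega : n ≠ 0) x
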